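/- Let $1\le n\le\infty$. **$\mathcal C^n$ spaces.** A $\mathcal C^n$ space $X$ is a set together with, for every open $U\subseteq\mathbb R^k$ ($k\in\mathbb N$), a set of maps $U\to X$ (figures), such that constant maps are figures, $d\circ f$ is a figure whenever $d$ is a figure and $f$ is a $C^n$ map between open sets, and a map that is locally a figure is a figure. Arrows of $\mathcal C^n$ are the maps that take figures to figures by composition. $X$ carries the final topology of its figures; a subset $S\subseteq X$ has as figures the maps into $S$ that are figures of $X$. A $C^n$ manifold is a $\mathcal C^n$ space with the $C^n$ maps $U\to M$ as figures. An observable of $X$ is an arrow $\varphi:U\to K$ of $\mathcal C^n$ with $U$ open in $X$ and $K$ open in some $\mathbb R^k$. **Extension.** A path $x:\mathbb R\to X$ is nilpotent if it is continuous at $0$ and for every observable $\varphi:U\to K$ with $x_0\in U$ there is $m\in\mathbb N$ with $\|\varphi(x_t)-\varphi(x_0)\|^m=o(t)$ as $t\to0$. For nilpotent paths put $x\sim y$ if for every observable $\varphi:U\to K$ one has $x_0\in U\Leftrightarrow y_0\in U$ and, in that case, $\varphi(x_t)=\varphi(y_t)+o(t)$. Let ${}^\bullet X$ be the set of classes, and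 for an arrow $f:X\to Y$ put ${}^\bullet f([x])=[f\circ x]$. A point $a\in X$ gives the class of the constant path $a$ in ${}^\bullet X$. For $V$ open in $\mathbb R^s$ regard ${}^\bullet V\subseteq{}^\bullet(\mathbb R^s)$. Let $D\subseteq{}^\bullet\mathbb R$ be the set of classes of paths $h$ with $h(t)=O(t)$ as $t\to0$. **Extended spaces.** Give ${}^\bullet(\mathbb R^s)$ the topology generated by the sets ${}^\bullet V$, $V$ open in $\mathbb R^s$, and its subsets the induced topology. For $S\subseteq{}^\bullet(\mathbb R^s)$, $T\subseteq{}^\bullet(\mathbb R^r)$ call $f:S\to T$ admissible if for each $x_0\in S$ there are $q\in\mathbb N$, open sets $U\subseteq\mathbb R^q$ and $V\subseteq\mathbb R^s$, $p\in{}^\bullet U$ and $g\in C^n(U\times V,\mathbb R^r)$ with $x_0\in{}^\bullet V$ and $f(x)={}^\bullet g\langle p,x\rangle$ for all $x\in S\cap{}^\bullet V$, where $\langle p,x\rangle\in{}^\bullet(U\times V)$ is the point with components $p$ and $x$. For a $\mathcal C^n$ space $X$ and $Z\subseteq{}^\bullet X$, a generating figure $T\to Z$ is a map that is either constant or of the form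 ${}^\bullet h|_T$ with $h:V\to X$ a figure of $X$, $V$ open and $T\subseteq{}^\bullet V$. A figure $\delta:S\to Z$ is a map such that each point of $S$ has an open neighbourhood in $S$ on which $\delta$ is the composition of an admissible map into some $T\subseteq{}^\bullet(\mathbb R^r)$ and a generating figure $T\to Z$. An arrow of ${}^\bullet\mathcal C^n$ from $Z\subseteq{}^\bullet X$ to $W\subseteq{}^\bullet Y$ is a map $Z\to W$ that takes figures to figures by composition. **Theorem.** Let $M$ be a finite-dimensional smooth manifold and let $t:D\to{}^\bullet M$ be a tangent vector, i.e. an arrow of ${}^\bullet\mathcal C^n$. Then $t$ is standard, that is $t={}^\bullet f|_D$ for some $f\in C^\infty(\mathbb R,M)$, if and only if $t(0)\in M$, that is $t(0)$ is the class of a constant path. -/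

import Mathlib

open Set Filter Topology Asymptotics TopologicalSpace
open scoped Manifold ContDiff

noncomputable section

namespace InfGeom

/-- The Euclidean space `ℝᵏ`. -/
abbrev E (k : ℕ) : Type := EuclideanSpace ℝ (Fin k)

/-! ### `Cⁿ` spaces -/

/-- A `Cⁿ` space on the set `X` (a diffeological space if `n = ∞`): for every open `U ⊆ ℝᵏ` a set of
figures `U → X`, closed under `Cⁿ` reparametrization, containing the constant maps, and local. -/
structure CnSpace (n : ℕ∞) (X : Type*) where
  IsFigure : ∀ {k : ℕ} (U : Opens (E k)), (U → X) → Prop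
  comp : ∀ {k l : ℕ} {U : Opens (E k)} {V : Opens (E l)} (f : U → V) (d : V → X),
    ContMDiff (𝓡 k) (𝓡 l) n f → IsFigure V d → IsFigure U (d ∘ f)
  const : ∀ {k : ℕ} (U : Opens (E k)) (x : X), IsFigure U (fun _ => x)
  sheaf : ∀ {k : ℕ} (U : Opens (E k)) (d : U → X),
    (∀ x : U, ∃ (V : Opens (E k)) (hVU : V ≤ U), (x : E k) ∈ V ∧
      IsFigure V (fun y => d ⟨y, hVU y.2⟩)) → IsFigure U d

namespace CnSpace

variable {n : ℕ∞} {X Y Z : Type*}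

/-- Arrows of the category `Cⁿ`: the maps that take figures to figures. -/
def Arrow (A : CnSpace n X) (B : CnSpace n Y) (f : X → Y) : Prop :=
  ∀ {k : ℕ} (U : Opens (E k)) (d : U → X), A.IsFigure U d → B.IsFigure U (f ∘ d)

/-- The final topology with respect to all figures. -/
@[reducible] def topology (A : CnSpace n X) : TopologicalSpace X where
  IsOpen S := ∀ {k : ℕ} (U : Opens (E k)) (d : U → X), A.IsFigure U d → IsOpen (d ⁻¹' S)
  isOpen_univ := fun _ _ _ => isOpen_univ
  isOpen_inter := fun _ _ hS hT _ U d hd => (hS U d hd).inter (hT U d hd)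
  isOpen_sUnion := fun 𝒮 h𝒮 _ U d hd => by
    rw [preimage_sUnion]
    exact isOpen_biUnion fun S hS => h𝒮 S hS U d hd

/-- The subspace `(S ≺ X)`. -/
def subspace (A : CnSpace n X) (S : Set X) : CnSpace n S where
  IsFigure U d := A.IsFigure U (fun x => (d x : X))
  comp f d hf hd := A.comp f (fun x => (d x : X)) hf hd
  const U x := A.const U (x : X)
  sheaf U d h := A.sheaf U (fun x => (d x : X)) h

section Manifold

variable {F : Type*} [NormedAddCommGroup F] [NormedSpace ℝ F] {H : Type*} [TopologicalSpace H]
  (I : ModelWithCorners ℝ F H) (M : Type*) [TopologicalSpace M] [ChartedSpace H M]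
  {F' : Type*} [NormedAddCommGroup F'] [NormedSpace ℝ F'] {H' : Type*} [TopologicalSpace H']
  (I' : ModelWithCorners ℝ F' H') (M' : Type*) [TopologicalSpace M'] [ChartedSpace H' M']

/-- The `Cⁿ` space of a manifold `M`: the figures are the `Cⁿ` maps `U → M`. -/
def ofManifold (n : ℕ∞) : CnSpace n M where
  IsFigure {k} _ d := ContMDiff (𝓡 k) I n d
  comp _ _ hf hd := hd.comp hf
  const _ _ := contMDiff_const
  sheaf {k} U d h := by
    classical
    intro x
    obtain ⟨V, hVU, hxV, hV⟩ := h x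
    let D : E k → M := fun y => if hy : y ∈ U then d ⟨y, hy⟩ else d x
    have h1 : d = fun y : U => D y := by
      funext y; simp [D]
    have h2 : (fun y : V => d ⟨y, hVU y.2⟩) = fun y : V => D y := by
      funext y; have := hVU y.2; simp [D, this]
    rw [h2] at hV
    rw [h1, contMDiffAt_subtype_iff]
    have h3 := hV ⟨x, hxV⟩
    rw [contMDiffAt_subtype_iff] at h3
    exact h3

variable {I M I' M'}

/-- `Cⁿ` maps between manifolds are arrows of `Cⁿ`. -/
theorem arrow_of_contMDiff {f : M → M'} (hf : ContMDiff I I' n f) :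
    Arrow (ofManifold I M n) (ofManifold I' M' n) f :=
  fun _ _ hd => hf.comp hd

end Manifold

/-- `c` is an observable of `A` on the zone `UK`: `U` is open in `A`, `K` is open in `ℝᵏ`, and `c`
restricts to an arrow `(U ≺ A) → K` of `Cⁿ`. The values of `c` outside `U` play no role. -/
def IsObservable (A : CnSpace n X) {k : ℕ} (U : Set X) (K : Opens (E k)) (c : X → E k) : Prop :=
  IsOpen[A.topology] U ∧ ∃ h : MapsTo c U K,
    Arrow (A.subspace U) (ofManifold (𝓡 k) K n) (h.restrict c U K)

/-! ### Nilpotent paths and the extension by infinitesimal points -/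

/-- Nilpotent paths in `A`: continuous at `0`, and `‖φ(x_t) - φ(x_0)‖ᵐ = o(t)` for some `m`, for every
observable `φ` defined at `x_0`. -/
def IsNilpotentPath (A : CnSpace n X) (x : ℝ → X) : Prop :=
  @ContinuousAt ℝ X _ A.topology x 0 ∧
  ∀ {k : ℕ} (U : Set X) (K : Opens (E k)) (φ : X → E k), A.IsObservable U K φ → x 0 ∈ U →
    ∃ m : ℕ, (fun t => ‖φ (x t) - φ (x 0)‖ ^ m) =o[𝓝 0] fun t : ℝ => t

/-- The set of nilpotent paths. -/
def NilpotentPath (A : CnSpace n X) : Type _ := {x : ℝ → X // A.IsNilpotentPath x}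

/-- `x ∼ y`: for every observable `φ` on `UK`, `x_0 ∈ U ↔ y_0 ∈ U`, and in this case
`φ(x_t) = φ(y_t) + o(t)`. -/
def pathSetoid (A : CnSpace n X) : Setoid A.NilpotentPath where
  r x y := ∀ {k : ℕ} (U : Set X) (K : Opens (E k)) (φ : X → E k), A.IsObservable U K φ →
    (x.1 0 ∈ U ↔ y.1 0 ∈ U) ∧
      (x.1 0 ∈ U → (fun t => φ (x.1 t) - φ (y.1 t)) =o[𝓝 0] fun t : ℝ => t)
  iseqv :=
    { refl := fun x _ U K φ _ => ⟨Iff.rfl, fun _ => by simp⟩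
      symm := fun {x y} h _ U K φ hφ => ⟨(h U K φ hφ).1.symm, fun hy => by
        have := ((h U K φ hφ).2 ((h U K φ hφ).1.2 hy)).neg_left
        simpa using this⟩
      trans := fun {x y z} h h' _ U K φ hφ => ⟨(h U K φ hφ).1.trans (h' U K φ hφ).1, fun hx => by
        have := ((h U K φ hφ).2 hx).add ((h' U K φ hφ).2 ((h U K φ hφ).1.1 hx))
        simpa using this⟩ }

/-- The extension `•A` of a `Cⁿ` space `A`. -/
def Ext (A : CnSpace n X) : Type _ := Quotient A.pathSetoid

/-- Arrows are continuous. -/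
theorem Arrow.isOpen_preimage {A : CnSpace n X} {B : CnSpace n Y} {f : X → Y} (hf : Arrow A B f)
    {S : Set Y} (hS : IsOpen[B.topology] S) : IsOpen[A.topology] (f ⁻¹' S) :=
  fun U d hd => hS U (f ∘ d) (hf U d hd)

/-- Observables can be pulled back along arrows. -/
theorem IsObservable.comp {A : CnSpace n X} {B : CnSpace n Y} {f : X → Y} (hf : Arrow A B f)
    {k : ℕ} {U : Set Y} {K : Opens (E k)} {φ : Y → E k} (hφ : B.IsObservable U K φ) :
    A.IsObservable (f ⁻¹' U) K (φ ∘ f) := by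
  obtain ⟨hU, hm, ha⟩ := hφ
  refine ⟨hf.isOpen_preimage hU, fun x hx => hm hx, fun W d hd => ?_⟩
  exact ha W (fun w => ⟨f (d w), (d w).2⟩) (hf W (fun w => (d w : X)) hd)

/-- Arrows preserve nilpotent paths. -/
theorem IsNilpotentPath.comp {A : CnSpace n X} {B : CnSpace n Y} {f : X → Y} (hf : Arrow A B f)
    {x : ℝ → X} (hx : A.IsNilpotentPath x) : B.IsNilpotentPath (f ∘ x) := by
  refine ⟨?_, fun U K φ hφ h0 =>
    hx.2 (f ⁻¹' U) K (φ ∘ f) (IsObservable.comp hf hφ) h0⟩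
  have hc : @Continuous X Y A.topology B.topology f :=
    @Continuous.mk X Y A.topology B.topology f fun S hS => hf.isOpen_preimage hS
  exact @ContinuousAt.comp ℝ X Y _ A.topology B.topology x 0 f
    (@Continuous.continuousAt X Y A.topology B.topology f (x 0) hc) hx.1

/-- The extension `•f : •A → •B`, `[x] ↦ [f ∘ x]`, of an arrow `f : A → B` of `Cⁿ`. -/
def Ext.map {A : CnSpace n X} {B : CnSpace n Y} (f : X → Y) (hf : Arrow A B f) : A.Ext → B.Ext :=
  Quotient.map' (s₁ := A.pathSetoid) (s₂ := B.pathSetoid)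
    (fun x => ⟨f ∘ x.1, IsNilpotentPath.comp hf x.2⟩)
    (fun _ _ h _ _ K _ hφ => h _ K _ (hφ.comp hf))

theorem isNilpotentPath_const (A : CnSpace n X) (a : X) : A.IsNilpotentPath fun _ => a :=
  ⟨@continuousAt_const ℝ X _ A.topology 0 a, fun _ _ _ _ _ => ⟨1, by simp⟩⟩

/-- The ordinary point `a`, seen as a point of `•A` through the constant path. -/
def Ext.const (A : CnSpace n X) (a : X) : A.Ext :=
  Quotient.mk A.pathSetoid ⟨fun _ => a, A.isNilpotentPath_const a⟩

end CnSpace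

open CnSpace

/-! ### The category of types of figures of extended spaces -/

section Extended

variable (n : ℕ∞)

/-- `•(ℝˢ)`. -/
abbrev ExtE (s : ℕ) : Type := (ofManifold (𝓡 s) (E s) n).Ext

/-- `•V` for `V` open in `ℝˢ`. -/
abbrev ExtOpens {s : ℕ} (V : Opens (E s)) : Type := (ofManifold (𝓡 s) V n).Ext

/-- `•(U × V)` for `U` open in `ℝ^q` and `V` open in `ℝˢ`. -/
abbrev ExtProd {q s : ℕ} (U : Opens (E q)) (V : Opens (E s)) : Type :=
  (ofManifold ((𝓡 q).prod (𝓡 s)) (U × V) n).Ext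

variable {n}

/-- The injection `•V → •(ℝˢ)` induced by the inclusion `V ⊆ ℝˢ`. -/
def ExtOpens.incl {s : ℕ} {V : Opens (E s)} : ExtOpens n V → ExtE n s :=
  Ext.map (Subtype.val : V → E s) (arrow_of_contMDiff contMDiff_subtype_val)

/-- The first component `•(U × V) → •U ⊆ •(ℝ^q)`. -/
def ExtProd.fst {q s : ℕ} {U : Opens (E q)} {V : Opens (E s)} : ExtProd n U V → ExtE n q :=
  Ext.map (fun w : U × V => (w.1 : E q))
    (arrow_of_contMDiff (contMDiff_subtype_val.comp contMDiff_fst))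

/-- The second component `•(U × V) → •V ⊆ •(ℝˢ)`. -/
def ExtProd.snd {q s : ℕ} {U : Opens (E q)} {V : Opens (E s)} : ExtProd n U V → ExtE n s :=
  Ext.map (fun w : U × V => (w.2 : E s))
    (arrow_of_contMDiff (contMDiff_subtype_val.comp contMDiff_snd))

/-- `•V` as a subset of `•(ℝˢ)`. -/
def extSet {s : ℕ} (V : Opens (E s)) : Set (ExtE n s) := range (ExtOpens.incl (n := n) (V := V))

/-- The topology of `•(ℝˢ)`, generated by the sets `•V` with `V` open in `ℝˢ`. Subsets of `•(ℝˢ)` carry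
the induced topology, which is generated by the sets `•V ∩ S`. -/
@[reducible] def extTopology (s : ℕ) : TopologicalSpace (ExtE n s) :=
  TopologicalSpace.generateFrom (range (extSet (n := n) (s := s)))

/-- Arrows between `S ⊆ •(ℝˢ)` and `T ⊆ •(ℝᵗ)`: near every point, `f(x) = •g⟨p, x⟩` with a fixed
parameter `p ∈ •U ⊆ •(ℝ^q)` and a `Cⁿ` map `g : U × V → ℝᵗ`. Here `⟨p, x⟩` is the point of `•(U × V)`
with components `p` and `x`. -/
def SArrow {s t : ℕ} (S : Set (ExtE n s)) (T : Set (ExtE n t)) (f : S → T) : Prop :=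
  ∀ x₀ : S, ∃ (q : ℕ) (p : ExtE n q) (U : Opens (E q)) (V : Opens (E s)) (g : U × V → E t)
    (hg : ContMDiff ((𝓡 q).prod (𝓡 s)) (𝓡 t) n g),
    p ∈ extSet U ∧ (x₀ : ExtE n s) ∈ extSet V ∧
    ∀ x : S, (x : ExtE n s) ∈ extSet V → ∃ w : ExtProd n U V,
      w.fst = p ∧ w.snd = x ∧ (f x : ExtE n t) = Ext.map g (arrow_of_contMDiff hg) w

/-! ### Extended spaces -/

variable {X Y : Type*}

/-- The generating figures `d : T → Z` of the extended space on `Z ⊆ •A`, where `T ⊆ •(ℝᵗ)`: constant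
maps, and restrictions to `T` of maps `•h : •V → •A` with `T ⊆ •V` and `h : V → A` a figure of `A`
(equivalently, an arrow `V → A` of `Cⁿ`). -/
def IsGeneratingFigure (A : CnSpace n X) (Z : Set A.Ext) {t : ℕ} (T : Set (ExtE n t))
    (d : T → Z) : Prop :=
  (∃ z : Z, ∀ x, d x = z) ∨
  ∃ (V : Opens (E t)) (h : V → X) (hh : Arrow (ofManifold (𝓡 t) V n) A h),
    ∀ x : T, ∃ v : ExtOpens n V, v.incl = x ∧ (d x : A.Ext) = Ext.map h hh v

/-- The figures `δ : S → Z` (with `S ⊆ •(ℝˢ)`) of the extended space induced on `Z ⊆ •A` by `A`: near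
every point `δ` is an arrow `S ∩ W → T` followed by a generating figure `T → Z`. -/
def IsExtFigure (A : CnSpace n X) (Z : Set A.Ext) {s : ℕ} (S : Set (ExtE n s))
    (δ : S → Z) : Prop :=
  ∀ x₀ : S, ∃ W : Set (ExtE n s), IsOpen[extTopology s] W ∧ (x₀ : ExtE n s) ∈ W ∧
    ∃ (t : ℕ) (T : Set (ExtE n t)) (f : ↥(S ∩ W) → T) (d : T → Z),
      SArrow (S ∩ W) T f ∧ IsGeneratingFigure A Z T d ∧
      ∀ x : ↥(S ∩ W), δ ⟨x, x.2.1⟩ = d (f x)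

/-- Arrows of the category `•Cⁿ` between the extended spaces induced on `Z ⊆ •A` and `W ⊆ •B`: the maps
that take figures to figures. -/
def ExtArrow (A : CnSpace n X) (Z : Set A.Ext) (B : CnSpace n Y) (W : Set B.Ext)
    (f : Z → W) : Prop :=
  ∀ {s : ℕ} (S : Set (ExtE n s)) (δ : S → Z), IsExtFigure A Z S δ → IsExtFigure B W S (f ∘ δ)

/-! ### First order infinitesimals and tangent vectors -/

variable (n) in
/-- The real line as a `Cⁿ` space. -/
abbrev realLine : CnSpace n ℝ := ofManifold 𝓘(ℝ, ℝ) ℝ n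

variable (n) in
/-- The first order infinitesimals `D ⊆ •ℝ`: the classes of paths `h` with `h(t) = O(t)`. -/
def D : Set (realLine n).Ext :=
  {h | ∃ x : (realLine n).NilpotentPath, Quotient.mk (realLine n).pathSetoid x = h ∧
    x.1 =O[𝓝 0] fun t : ℝ => t}

variable (n) in
/-- The point `0` of `D`. -/
def D.zero : D n :=
  ⟨Ext.const (realLine n) 0, ⟨fun _ => 0, (realLine n).isNilpotentPath_const 0⟩, rfl,
    isBigO_zero _ _⟩

section Tangent

variable (n)
variable (d : ℕ) (M : Type*) [TopologicalSpace M] [ChartedSpace (E d) M]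

/-- The extension `•M` of the manifold `M`. -/
abbrev ExtManifold : Type _ := (ofManifold (𝓡 d) M n).Ext

/-- Tangent vectors `t : D → •M`, i.e. arrows of `•Cⁿ`. -/
def TangentVector : Type _ :=
  {t : D n → ExtManifold n d M //
    ExtArrow (realLine n) (D n) (ofManifold (𝓡 d) M n) univ fun h => ⟨t h, mem_univ (t h)⟩}

/-- The standard tangent vectors: those of the form `•f|_D` with `f : ℝ → M` smooth. -/
def StandardTangentVector : Set (TangentVector n d M) :=
  {t | ∃ (f : ℝ → M) (hf : ContMDiff 𝓘(ℝ, ℝ) (𝓡 d) ∞ f), ∀ h : D n,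
    t.1 h = Ext.map f (arrow_of_contMDiff (hf.of_le (mod_cast le_top))) (h : (realLine n).Ext)}

/-- `M` as the subset of ordinary points of `•M`. -/
def ordinaryPoints : Set (ExtManifold n d M) := range (Ext.const (ofManifold (𝓡 d) M n))

end Tangent

end Extended

end InfGeom

end

/-! The substance is the converse. Transported to `•(ℝ¹)`, the identity of `D` is a figure, so near
`0` the vector `t` is either constant or of the form `•k ∘ •g⟨p, ·⟩`. Every open set around `0`
contains all of `D` (`extLift_mem_of_isOpen`), so this local form is valid on `D`.

With `b` the unit vector of `ℝ¹`, the point `t[x]` is represented, up to `o(t)` in each argument, by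
`k(g(p_t, x_t b))`. The parameter `p` may be an infinitesimal larger than `O(t)`, so expanding at
its standard part leaves an error that need not be `o(t)`. Strict differentiability compares two
moving arguments instead: since `x_t b = O(t)`, in a chart `k(g(p_t, x_t b)) - k(g(p_t, 0)) = L₂ L₁
(0, x_t b) + o(t)`, with `L₁`, `L₂` the derivatives at the standard points. The subtracted path
represents `t(0)`, hence is `a + o(t)` when `t(0) = a` is ordinary. So `t` agrees on `D` with any
smooth curve through `a` of velocity `L₂ L₁ (0, b)` (`exists_map_eq`). One chart suffices to
identify points of `•M`, because observables are `Cⁿ` and `n ≥ 1` (`mk_eq_of_isLittleO`). -/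

namespace InfGeom

open CnSpace

/-! ### Nilpotent paths and observables in manifolds -/

section General

variable {F : Type*} [NormedAddCommGroup F] [NormedSpace ℝ F] {H : Type*} [TopologicalSpace H]
  {I : ModelWithCorners ℝ F H} {M : Type*} [TopologicalSpace M] [ChartedSpace H M]
  {F' : Type*} [NormedAddCommGroup F'] [NormedSpace ℝ F'] {H' : Type*} [TopologicalSpace H']
  {I' : ModelWithCorners ℝ F' H'} {M' : Type*} [TopologicalSpace M'] [ChartedSpace H' M']
  {n : ℕ∞}

/-- Strict differentiability of a `C¹` map between boundaryless manifolds, tested on two functions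
which tend to the same point. -/
theorem exists_isLittleO_of_contMDiffAt [I.Boundaryless] {f : M → M'} {a : M}
    (hf : ContMDiffAt I I' 1 f a) :
    ∃ L : F →L[ℝ] F', ∀ {α : Type} {l : Filter α} {x y : α → M},
      Tendsto x l (𝓝 a) → Tendsto y l (𝓝 a) →
      (fun t => extChartAt I' (f a) (f (x t)) - extChartAt I' (f a) (f (y t)) -
          L (extChartAt I a (x t) - extChartAt I a (y t))) =o[l]
        fun t => extChartAt I a (x t) - extChartAt I a (y t) := by
  have h := (contMDiffAt_iff.1 hf).2
  -- Without boundary the chart point is interior, and there `C¹` implies strict differentiability.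
  rw [I.range_eq_univ, contDiffWithinAt_univ] at h
  have hs := (h.hasStrictFDerivAt one_ne_zero).isLittleO
  have he := continuousAt_extChartAt (I := I) a
  refine ⟨fderiv ℝ (extChartAt I' (f a) ∘ f ∘ (extChartAt I a).symm) (extChartAt I a a),
    fun {α l x y} hx hy => ?_⟩
  refine (hs.comp_tendsto ((he.tendsto.comp hx).prodMk_nhds (he.tendsto.comp hy))).congr' ?_
    (Eventually.of_forall fun t => rfl)
  filter_upwards [hx (extChartAt_source_mem_nhds (I := I) a),
    hy (extChartAt_source_mem_nhds (I := I) a)] with t h1 h2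
  simp only [Function.comp_apply, (extChartAt I a).left_inv h1, (extChartAt I a).left_inv h2]

theorem isOpen_topology_ofManifold {S : Set M} (hS : IsOpen S) :
    IsOpen[(ofManifold I M n).topology] S :=
  fun _ _ hd => hS.preimage (ContMDiff.continuous hd)

theorem contMDiff_codRestrict {m : ℕ∞} {U : Opens M'} (f : M → U)
    (hf : ContMDiff I I' m fun x => (f x : M')) : ContMDiff I I' m f :=
  fun x => (ChartedSpace.liftPropWithinAt_subtypeVal_comp_iff f univ x).1 (hf x)

/-- Nilpotent paths in a manifold are continuous at `0` for the topology of the manifold. -/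
theorem tendsto_of_isNilpotentPath {x : ℝ → M} (hx : (ofManifold I M n).IsNilpotentPath x) :
    Tendsto x (𝓝 0) (𝓝 (x 0)) :=
  hx.1.mono_right
    (nhds_mono (t₁ := (ofManifold I M n).topology) fun _ => isOpen_topology_ofManifold)

/-- A map from a manifold to `ℝᵏ` which is `Cⁿ` on an open set is an observable. -/
theorem isObservable_of_contMDiffOn {k : ℕ} {U : Set M} (hU : IsOpen U) {c : M → E k}
    (hc : ContMDiffOn I (𝓡 k) n c U) : (ofManifold I M n).IsObservable U ⊤ c := by
  refine ⟨isOpen_topology_ofManifold hU, fun _ _ => trivial, fun W d hd => ?_⟩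
  exact contMDiff_codRestrict _ (hc.comp_contMDiff hd fun w => (d w).2)

/-- The filter `𝓝 0` includes `t = 0`, where the bound is a multiple of `|0|`. Hence paths that
agree up to `o(t)` have the same standard part. -/
theorem eq_zero_of_isLittleO {G : Type*} [NormedAddCommGroup G] {f : ℝ → G}
    (hf : f =o[𝓝 0] fun t : ℝ => t) : f 0 = 0 := by
  simpa using (hf.def one_pos).self_of_nhds

theorem eq_of_isLittleO_sub {G : Type*} [NormedAddCommGroup G] {f g : ℝ → G}
    (h : (fun t => f t - g t) =o[𝓝 0] fun t : ℝ => t) : f 0 = g 0 :=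
  sub_eq_zero.1 (eq_zero_of_isLittleO h)

/-- Equivalent nilpotent paths in a manifold agree up to `o(t)` in every `Cⁿ` coordinate. -/
theorem isLittleO_of_mk_eq {x y : (ofManifold I M n).NilpotentPath}
    (h : Quotient.mk (ofManifold I M n).pathSetoid x = Quotient.mk _ y) {k : ℕ} {U : Set M}
    (hU : IsOpen U) {c : M → E k} (hc : ContMDiffOn I (𝓡 k) n c U) (hx : x.1 0 ∈ U) :
    (fun t => c (x.1 t) - c (y.1 t)) =o[𝓝 0] fun t : ℝ => t :=
  (Quotient.exact h U ⊤ c (isObservable_of_contMDiffOn hU hc)).2 hx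

end General

/-! ### Equality in the extension, tested in one chart -/

section Euclidean

variable {n : ℕ∞} {d : ℕ} {M : Type*} [TopologicalSpace M] [ChartedSpace (E d) M]
  [IsManifold (𝓡 d) n M]

/-- The inverse chart is a figure. It therefore detects that the chart image of `U`, open a priori
only in the final topology, is open, and that `c` is `Cⁿ` in coordinates. -/
theorem contMDiffAt_of_isObservable {k : ℕ} {U : Set M} {K : Opens (E k)} {c : M → E k}
    (hc : (ofManifold (𝓡 d) M n).IsObservable U K c) {a : M} (ha : a ∈ U) :
    ContMDiffAt (𝓡 d) (𝓡 k) n c a := by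
  obtain ⟨hU, hm, hA⟩ := hc
  have hs : ContMDiff (𝓡 d) (𝓡 d) n
      (fun v : (⟨(chartAt (E d) a).target, (chartAt (E d) a).open_target⟩ : Opens (E d)) =>
        (chartAt (E d) a).symm v) :=
    (contMDiffOn_chart_symm (I := 𝓡 d)).comp_contMDiff contMDiff_subtype_val fun v => v.2
  have hO : IsOpen ((chartAt (E d) a).target ∩ (chartAt (E d) a).symm ⁻¹' U) := by
    have h := (hU _ _ hs)
    have := (chartAt (E d) a).open_target.isOpenMap_subtype_val _ h
    convert this using 1
    ext v
    simp [and_comm]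
  let O : Opens (E d) := ⟨_, hO⟩
  have hs' : ContMDiff (𝓡 d) (𝓡 d) n (fun v : O => (chartAt (E d) a).symm v) :=
    (contMDiffOn_chart_symm (I := 𝓡 d)).comp_contMDiff contMDiff_subtype_val fun v => v.2.1
  have h1 : ContMDiff (𝓡 d) (𝓡 k) n (fun v : O => c ((chartAt (E d) a).symm v)) :=
    contMDiff_subtype_val.comp (hA O (fun v => ⟨(chartAt (E d) a).symm v, v.2.2⟩) hs')
  have haO : chartAt (E d) a a ∈ O :=
    ⟨mem_chart_target _ a, by simpa [(chartAt (E d) a).left_inv (mem_chart_source _ a)] using ha⟩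
  have h2 : ContMDiffAt (𝓡 d) (𝓡 k) n (c ∘ (chartAt (E d) a).symm) (chartAt (E d) a a) :=
    contMDiffAt_subtype_iff (x := (⟨_, haO⟩ : O)).1 (h1 ⟨_, haO⟩)
  have h3 : ContMDiffAt (𝓡 d) (𝓡 d) n (chartAt (E d) a) a :=
    contMDiffOn_chart.contMDiffAt (chart_source_mem_nhds _ a)
  refine (h2.comp a h3).congr_of_eventuallyEq ?_
  filter_upwards [chart_source_mem_nhds (E d) a] with y hy
  simp [(chartAt (E d) a).left_inv hy]

/-- Nilpotent paths in a manifold are equivalent if they agree up to `o(t)` in one chart. -/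
theorem mk_eq_of_isLittleO (hn : 1 ≤ n) {x y : (ofManifold (𝓡 d) M n).NilpotentPath}
    (h0 : x.1 0 = y.1 0)
    (h : (fun t => extChartAt (𝓡 d) (x.1 0) (x.1 t) - extChartAt (𝓡 d) (x.1 0) (y.1 t))
      =o[𝓝 0] fun t : ℝ => t) :
    Quotient.mk (ofManifold (𝓡 d) M n).pathSetoid x = Quotient.mk _ y := by
  refine Quotient.sound fun U K c hc => ⟨by rw [h0], fun hx => ?_⟩
  -- The strict derivative of the observable carries the `o(t)` estimate from the chart to `c`.
  obtain ⟨L, hL⟩ := exists_isLittleO_of_contMDiffAt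
    ((contMDiffAt_of_isObservable hc hx).of_le (mod_cast hn))
  have h1 := hL (tendsto_of_isNilpotentPath x.2) (h0 ▸ tendsto_of_isNilpotentPath y.2)
  have h2 := (h1.trans h).add ((L.isBigO_comp _ _).trans_isLittleO h)
  exact h2.congr_left fun t => sub_add_cancel (c (x.1 t) - c (y.1 t)) _

/-- Substituting `s = x_t = O(t)` turns an error `o(s)` into `o(t)`, so `D` sees only the 1-jet of a
curve at `0`. -/
theorem map_eq_map_of_isLittleO (hn : 1 ≤ n) {x : (realLine n).NilpotentPath}
    (hx : x.1 =O[𝓝 0] fun t : ℝ => t) {f g : ℝ → M}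
    (hf : Arrow (realLine n) (ofManifold (𝓡 d) M n) f)
    (hg : Arrow (realLine n) (ofManifold (𝓡 d) M n) g) (h0 : f 0 = g 0)
    (h : (fun s => extChartAt (𝓡 d) (f 0) (f s) - extChartAt (𝓡 d) (f 0) (g s))
      =o[𝓝 0] fun s : ℝ => s) :
    Ext.map f hf (Quotient.mk _ x) = Ext.map g hg (Quotient.mk _ x) := by
  have hx0 : x.1 0 = 0 := by
    simpa using hx.eq_zero_imp.self_of_nhds
  have ht := tendsto_of_isNilpotentPath x.2
  rw [hx0] at ht
  refine mk_eq_of_isLittleO (x := ⟨f ∘ x.1, x.2.comp hf⟩) (y := ⟨g ∘ x.1, x.2.comp hg⟩) hn ?_ ?_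
  · simp [hx0, h0]
  · simp only [Function.comp_apply, hx0]
    exact (h.comp_tendsto ht).trans_isBigO hx

end Euclidean

/-! ### Smooth curves with prescribed velocity -/

/-- Reparametrizing a segment by `r sin(s / r)`, which has derivative `1` at `0`, defines it for all
real `s` while it stays in a small ball of a chart. -/
theorem exists_contDiff_abs_le {r : ℝ} (hr : 0 < r) :
    ∃ σ : ℝ → ℝ, ContDiff ℝ ∞ σ ∧ (∀ s, |σ s| ≤ r) ∧ σ 0 = 0 ∧
      (fun s => σ s - s) =o[𝓝 0] fun s : ℝ => s := by
  refine ⟨fun s => r * Real.sin (s / r), by fun_prop, fun s => ?_, by simp, ?_⟩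
  · rw [abs_mul, abs_of_pos hr]
    exact mul_le_of_le_one_right hr.le (Real.abs_sin_le_one _)
  · have h : HasDerivAt (fun s => r * Real.sin (s / r)) (r * (Real.cos (0 / r) * (1 / r))) 0 :=
      (((hasDerivAt_id (0 : ℝ)).div_const r).sin).const_mul r
    have := h.isLittleO
    simpa [hr.ne'] using this

/-- Every point and every vector in a chart belong to a smooth curve. -/
theorem exists_contMDiff_curve {d : ℕ} {M : Type*} [TopologicalSpace M] [ChartedSpace (E d) M]
    [IsManifold (𝓡 d) ∞ M] (a : M) (c : E d) :
    ∃ f : ℝ → M, ContMDiff 𝓘(ℝ, ℝ) (𝓡 d) ∞ f ∧ f 0 = a ∧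
      (fun s : ℝ => extChartAt (𝓡 d) a (f s) - (extChartAt (𝓡 d) a a + s • c))
        =o[𝓝 0] fun s : ℝ => s := by
  obtain ⟨δ, hδ, hb⟩ := Metric.isOpen_iff.1 (isOpen_extChartAt_target (I := 𝓡 d) a) _
    (mem_extChartAt_target a)
  -- The `+ 1` allows `c = 0` and makes the bound by `δ` strict.
  have hc : 0 < ‖c‖ + 1 := by positivity
  obtain ⟨σ, hσ, hle, h0, hσ'⟩ := exists_contDiff_abs_le (div_pos hδ hc)
  have hmem : ∀ s, extChartAt (𝓡 d) a a + σ s • c ∈ (extChartAt (𝓡 d) a).target := by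
    intro s
    refine hb ?_
    rw [mem_ball_iff_norm, add_sub_cancel_left, norm_smul, Real.norm_eq_abs]
    calc |σ s| * ‖c‖ ≤ δ / (‖c‖ + 1) * ‖c‖ := by gcongr; exact hle s
      _ < δ / (‖c‖ + 1) * (‖c‖ + 1) := by gcongr; exact lt_add_one _
      _ = δ := div_mul_cancel₀ _ hc.ne'
  refine ⟨fun s => (extChartAt (𝓡 d) a).symm (extChartAt (𝓡 d) a a + σ s • c), ?_, ?_, ?_⟩
  · refine (contMDiffOn_extChartAt_symm a).comp_contMDiff ?_ hmem
    exact ContDiff.contMDiff (by fun_prop)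
  · simp [h0]
  · simp only [fun s => (extChartAt (𝓡 d) a).right_inv (hmem s), add_sub_add_left_eq_sub,
      ← sub_smul]
    have := (ContinuousLinearMap.toSpanSingleton ℝ c).isBigO_comp (fun s => σ s - s) (𝓝 0)
    simpa using this.trans_isLittleO hσ'

/-! ### Transport of `D` from `•ℝ` to `•(ℝ¹)`, where domains of figures live -/

section Line

variable {n : ℕ∞}

/-- The vector of `ℝ¹` with coordinate `1`. -/
noncomputable def lineVector : E 1 := EuclideanSpace.single 0 1

theorem arrow_smul_lineVector :
    Arrow (realLine n) (ofManifold (𝓡 1) (E 1) n) fun s : ℝ => s • lineVector :=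
  arrow_of_contMDiff (ContDiff.contMDiff (by fun_prop))

theorem arrow_coord : Arrow (ofManifold (𝓡 1) (E 1) n) (realLine n) fun v : E 1 => v 0 :=
  arrow_of_contMDiff (ContDiff.contMDiff (by fun_prop))

/-- The identification of `•ℝ` with `•(ℝ¹)`. -/
noncomputable def extLift (h : (realLine n).Ext) : ExtE n 1 :=
  Ext.map _ arrow_smul_lineVector h

/-- The identification of `•(ℝ¹)` with `•ℝ`. -/
noncomputable def extCoord (h : ExtE n 1) : (realLine n).Ext :=
  Ext.map _ arrow_coord h

theorem map_map_eq {X Y Z : Type*} {A : CnSpace n X} {B : CnSpace n Y} {C : CnSpace n Z}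
    {f : X → Y} {g : Y → Z} {k : X → Z} {hf : Arrow A B f} {hg : Arrow B C g} (hk : Arrow A C k)
    (h : ∀ x, g (f x) = k x) (x : A.Ext) : Ext.map g hg (Ext.map f hf x) = Ext.map k hk x := by
  induction x using Quotient.inductionOn with
  | h x => exact congrArg (Quotient.mk C.pathSetoid) (Subtype.ext (funext fun τ => h _))

theorem map_map_cancel {X Y : Type*} {A : CnSpace n X} {B : CnSpace n Y} {f : X → Y} {g : Y → X}
    {hf : Arrow A B f} {hg : Arrow B A g} (h : ∀ x, g (f x) = x) (x : A.Ext) :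
    Ext.map g hg (Ext.map f hf x) = x := by
  induction x using Quotient.inductionOn with
  | h x => exact congrArg (Quotient.mk A.pathSetoid) (Subtype.ext (funext fun τ => h _))

theorem extCoord_extLift (h : (realLine n).Ext) : extCoord (extLift h) = h :=
  map_map_cancel (fun _ => by simp [lineVector]) h

/-- `D` as a subset of `•(ℝ¹)`. -/
def lineD (n : ℕ∞) : Set (ExtE n 1) := {s | extCoord s ∈ D n}

/-- The coordinate `lineD n → D`. -/
noncomputable def lineDCoord (s : lineD n) : D n := ⟨extCoord s, s.2⟩

theorem arrow_subtypeVal {s : ℕ} (V : Opens (E s)) :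
    Arrow (ofManifold (𝓡 s) V n) (ofManifold (𝓡 s) (E s) n) Subtype.val :=
  arrow_of_contMDiff contMDiff_subtype_val

theorem arrow_codRestrict_top {s : ℕ} : Arrow (ofManifold (𝓡 s) (E s) n)
    (ofManifold (𝓡 s) (⊤ : Opens (E s)) n) fun v => ⟨v, trivial⟩ :=
  arrow_of_contMDiff (contMDiff_codRestrict _ contMDiff_id)

theorem arrow_snd {q s : ℕ} {U : Opens (E q)} {V : Opens (E s)} :
    Arrow (ofManifold ((𝓡 q).prod (𝓡 s)) (U × V) n) (ofManifold (𝓡 s) (E s) n)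
      fun w => (w.2 : E s) :=
  arrow_of_contMDiff (contMDiff_subtype_val.comp contMDiff_snd)

/-- No parameter is needed: take `q = 0` and `g` the second projection. -/
theorem sArrow_inclusion {s : ℕ} {S T : Set (ExtE n s)} (h : S ⊆ T) :
    SArrow S T (inclusion h) := by
  intro x₀
  refine ⟨0, Ext.const _ 0, ⊤, ⊤, fun w => w.2, contMDiff_subtype_val.comp contMDiff_snd,
    ⟨Ext.const _ ⟨0, trivial⟩, rfl⟩, ⟨Ext.map _ arrow_codRestrict_top x₀.1, ?_⟩, fun x _ => ?_⟩
  · exact map_map_cancel (hg := arrow_subtypeVal _) (fun _ => rfl) _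
  · have hw : Arrow (ofManifold (𝓡 s) (E s) n)
        (ofManifold ((𝓡 0).prod (𝓡 s)) ((⊤ : Opens (E 0)) × (⊤ : Opens (E s))) n)
        fun v => (⟨0, trivial⟩, ⟨v, trivial⟩) :=
      arrow_of_contMDiff (contMDiff_const.prodMk (contMDiff_codRestrict _ contMDiff_id))
    refine ⟨Ext.map _ hw x.1, ?_, ?_, ?_⟩
    · obtain ⟨x, hx⟩ := x
      induction x using Quotient.inductionOn with
      | h x => rfl
    · exact map_map_cancel (hg := arrow_snd) (fun _ => rfl) _
    · exact (map_map_cancel (hg := arrow_snd) (fun _ => rfl) _).symm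

/-- The coordinate is the extension of the linear map `v ↦ v 0`, hence a generating figure. This is
the figure on which the arrow `t` is tested. -/
theorem isExtFigure_lineDCoord : IsExtFigure (realLine n) (D n) (lineD n) lineDCoord := by
  intro x₀
  refine ⟨univ, @isOpen_univ _ (extTopology 1), mem_univ _, 1, lineD n,
    inclusion inter_subset_left, lineDCoord, sArrow_inclusion _, Or.inr ?_, fun _ => rfl⟩
  refine ⟨⊤, fun v => (v : E 1) 0,
    arrow_of_contMDiff ((ContDiff.contMDiff (by fun_prop) :
      ContMDiff (𝓡 1) 𝓘(ℝ, ℝ) n fun v : E 1 => v 0).comp contMDiff_subtype_val),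
    fun x => ⟨Ext.map _ arrow_codRestrict_top x.1, ?_, ?_⟩⟩
  · exact map_map_cancel (hg := arrow_subtypeVal _) (fun _ => rfl) _
  · exact (map_map_eq arrow_coord (fun _ => rfl) _).symm

theorem isLittleO_of_mk_eq_euclidean {s : ℕ} {x y : (ofManifold (𝓡 s) (E s) n).NilpotentPath}
    (h : Quotient.mk (ofManifold (𝓡 s) (E s) n).pathSetoid x = Quotient.mk _ y) :
    (fun t => x.1 t - y.1 t) =o[𝓝 0] fun t : ℝ => t :=
  isLittleO_of_mk_eq h isOpen_univ (c := id) contMDiffOn_id (mem_univ _)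

/-- Every open neighbourhood of `0` in `•(ℝ¹)` contains `D`. -/
theorem extLift_mem_of_isOpen (hn : 1 ≤ n) {W : Set (ExtE n 1)} (hW : IsOpen[extTopology 1] W)
    (h0 : extLift (D.zero n : (realLine n).Ext) ∈ W) (h : D n) :
    extLift (h : (realLine n).Ext) ∈ W := by
  obtain ⟨_, x, rfl, hx⟩ := h
  induction hW with
  | basic W hW =>
    obtain ⟨V, rfl⟩ := hW
    obtain ⟨v, hv⟩ := h0
    induction v using Quotient.inductionOn with
    | h v =>
      have hv0 : (v.1 0 : E 1) = 0 := by
        have := eq_zero_of_isLittleO (isLittleO_of_mk_eq_euclidean hv)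
        simpa using this
      -- The line `s • lineVector` may leave `V`. A smooth curve inside `V` with the same 1-jet has
      -- the same extension on `D` and takes its values in `•V`.
      obtain ⟨f, hf, hf0, hfo⟩ := exists_contMDiff_curve (v.1 0) lineVector
      have hfa : Arrow (realLine n) (ofManifold (𝓡 1) V n) f :=
        arrow_of_contMDiff (hf.of_le (mod_cast le_top))
      have hva : Arrow (realLine n) (ofManifold (𝓡 1) (E 1) n) fun s => (f s : E 1) :=
        arrow_of_contMDiff (contMDiff_subtype_val.comp (hf.of_le (mod_cast le_top)))
      refine ⟨Ext.map f hfa (Quotient.mk _ x), ?_⟩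
      refine (map_map_eq (hg := arrow_subtypeVal V) hva (fun _ => rfl) _).trans ?_
      refine map_eq_map_of_isLittleO hn hx hva arrow_smul_lineVector ?_ ?_
      · simp [hf0, hv0]
      · refine hfo.congr_left fun s => ?_
        change (f s : E 1) - ((v.1 0 : E 1) + s • lineVector) = (f s : E 1) - s • lineVector
        rw [hv0, zero_add]
  | univ => trivial
  | inter _ _ _ _ h1 h2 => exact ⟨h1 h0.1, h2 h0.2⟩
  | sUnion _ _ ih =>
    obtain ⟨W, hW, hW0⟩ := h0
    exact ⟨W, hW, ih W hW hW0⟩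

end Line

/-! ### First order expansion with a nonstandard parameter -/

/-- The composition of a figure of a manifold with a `Cⁿ` map with parameters which are fixed up to
`o(t)`, if it maps `0` to an ordinary point, is given on first order infinitesimals by a smooth
curve. -/
theorem exists_map_eq {n : ℕ∞} (hn : 1 ≤ n) {d : ℕ} {M : Type*} [TopologicalSpace M]
    [ChartedSpace (E d) M] [IsManifold (𝓡 d) ∞ M] {q s m : ℕ} {U : Opens (E q)} {V : Opens (E s)}
    {V' : Opens (E m)} {g : U × V → E m} (hg : ContMDiff ((𝓡 q).prod (𝓡 s)) (𝓡 m) n g)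
    {h : V' → M} (hh : Arrow (ofManifold (𝓡 m) V' n) (ofManifold (𝓡 d) M n) h)
    (b : E s) (p : ℝ → E q) (a : M)
    (v₀ : (ofManifold (𝓡 m) V' n).NilpotentPath)
    (w₀ : (ofManifold ((𝓡 q).prod (𝓡 s)) (U × V) n).NilpotentPath)
    (hv₀ : (fun t => (v₀.1 t : E m) - g (w₀.1 t)) =o[𝓝 0] fun t : ℝ => t)
    (hw₀ : (fun t => ((w₀.1 t).1 : E q) - p t) =o[𝓝 0] fun t : ℝ => t)
    (hw₀' : (fun t => ((w₀.1 t).2 : E s)) =o[𝓝 0] fun t : ℝ => t)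
    (ha : Ext.map h hh (Quotient.mk _ v₀) = Ext.const _ a) :
    ∃ (f : ℝ → M) (hf : ContMDiff 𝓘(ℝ, ℝ) (𝓡 d) ∞ f),
      ∀ (x : (realLine n).NilpotentPath) (v : (ofManifold (𝓡 m) V' n).NilpotentPath)
        (w : (ofManifold ((𝓡 q).prod (𝓡 s)) (U × V) n).NilpotentPath),
        x.1 =O[𝓝 0] (fun t : ℝ => t) →
        ((fun t => (v.1 t : E m) - g (w.1 t)) =o[𝓝 0] fun t : ℝ => t) →
        ((fun t => ((w.1 t).1 : E q) - p t) =o[𝓝 0] fun t : ℝ => t) →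
        ((fun t => ((w.1 t).2 : E s) - x.1 t • b) =o[𝓝 0] fun t : ℝ => t) →
        Ext.map h hh (Quotient.mk _ v) =
          Ext.map f (arrow_of_contMDiff (hf.of_le (mod_cast le_top))) (Quotient.mk _ x) := by
  have : IsManifold (𝓡 d) n M := .of_le (n := ∞) (mod_cast le_top)
  have hh' : ContMDiff (𝓡 m) (𝓡 d) n h := hh V' id contMDiff_id
  -- This is where the ordinary value at `0` enters: the base path is `a + o(t)` in the chart.
  have ho : (fun t => chartAt (E d) a (h (v₀.1 t)) - chartAt (E d) a a) =o[𝓝 0]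
      fun t : ℝ => t := by
    have h1 := isLittleO_of_mk_eq ha.symm (chartAt (E d) a).open_source
      (contMDiffOn_chart (I := 𝓡 d)) (mem_chart_source _ a)
    exact h1.neg_left.congr_left fun t => neg_sub _ _
  have hha : h (v₀.1 0) = a := by
    refine (chartAt (E d) a).injOn ?_ (mem_chart_source _ a)
      (sub_eq_zero.1 (eq_zero_of_isLittleO ho))
    exact ((Quotient.exact ha _ ⊤ _ (isObservable_of_contMDiffOn (chartAt (E d) a).open_source
      (contMDiffOn_chart (I := 𝓡 d)))).1).2 (mem_chart_source _ a)
  obtain ⟨L₁, hL₁⟩ := exists_isLittleO_of_contMDiffAt ((hg (w₀.1 0)).of_le (mod_cast hn))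
  obtain ⟨L₂, hL₂⟩ := exists_isLittleO_of_contMDiffAt ((hh' (v₀.1 0)).of_le (mod_cast hn))
  -- The velocity involves derivatives at the base points only, so one curve serves all `x`.
  obtain ⟨f, hf, hf0, hfo⟩ := exists_contMDiff_curve a (L₂ (L₁ (0, b)))
  refine ⟨f, hf, fun x v w hx hv hw hw' => ?_⟩
  have hx0 : x.1 0 = 0 := by simpa using hx.eq_zero_imp.self_of_nhds
  -- Strict differentiability needs both paths to tend to the same point.
  have hw0 : w.1 0 = w₀.1 0 := by
    refine Prod.ext (Subtype.ext ?_) (Subtype.ext ?_)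
    · exact (eq_of_isLittleO_sub hw).trans (eq_of_isLittleO_sub hw₀).symm
    · have h1 := eq_zero_of_isLittleO hw'
      rw [hx0, zero_smul, sub_zero] at h1
      exact h1.trans (eq_zero_of_isLittleO hw₀').symm
  have hv0 : v.1 0 = v₀.1 0 := by
    refine Subtype.ext ((eq_of_isLittleO_sub hv).trans ?_)
    rw [hw0]
    exact (eq_of_isLittleO_sub hv₀).symm
  have hxb : (fun t => ((0 : E q), x.1 t • b)) =O[𝓝 0] fun t : ℝ => t := by
    refine (isBigO_zero _ _).prod_left ?_
    simpa using ((ContinuousLinearMap.toSpanSingleton ℝ b).isBigO_comp x.1 _).trans hx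
  -- The parameter `p` cancels in the difference, which is therefore `O(t)` whatever the size of
  -- `p`.
  have hdw : (fun t => (((w.1 t).1 : E q), ((w.1 t).2 : E s)) -
      (((w₀.1 t).1 : E q), ((w₀.1 t).2 : E s)) - ((0 : E q), x.1 t • b)) =o[𝓝 0]
      fun t : ℝ => t := by
    refine IsLittleO.congr_left ((hw.sub hw₀).prod_left (hw'.sub hw₀')) fun t => ?_
    exact Prod.ext (by simp) (by simp; abel)
  have hdw' : (fun t => (((w.1 t).1 : E q), ((w.1 t).2 : E s)) -
      (((w₀.1 t).1 : E q), ((w₀.1 t).2 : E s))) =O[𝓝 0] fun t : ℝ => t := by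
    simpa using hdw.isBigO.add hxb
  have h₁ : (fun t => g (w.1 t) - g (w₀.1 t) - L₁ ((((w.1 t).1 : E q), ((w.1 t).2 : E s)) -
      (((w₀.1 t).1 : E q), ((w₀.1 t).2 : E s)))) =o[𝓝 0] fun t : ℝ => t :=
    (hL₁ (hw0 ▸ tendsto_of_isNilpotentPath w.2) (tendsto_of_isNilpotentPath w₀.2)).trans_isBigO
      hdw'
  have hdv : (fun t => (v.1 t : E m) - v₀.1 t - L₁ (0, x.1 t • b)) =o[𝓝 0] fun t : ℝ => t := by
    refine (((hv.sub hv₀).add h₁).add ((L₁.isBigO_comp _ _).trans_isLittleO hdw)).congr_left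
      fun t => ?_
    rw [map_sub L₁ _ (0, x.1 t • b)]
    abel
  have hdv' : (fun t => (v.1 t : E m) - v₀.1 t) =O[𝓝 0] fun t : ℝ => t := by
    simpa using hdv.isBigO.add ((L₁.isBigO_comp _ _).trans hxb)
  have h₂ : (fun t => chartAt (E d) a (h (v.1 t)) - chartAt (E d) a (h (v₀.1 t)) -
      L₂ ((v.1 t : E m) - v₀.1 t)) =o[𝓝 0] fun t : ℝ => t := by
    have := (hL₂ (hv0 ▸ tendsto_of_isNilpotentPath v.2)
      (tendsto_of_isNilpotentPath v₀.2)).trans_isBigO hdv'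
    rw [hha] at this
    exact this
  have hfx : (fun t => chartAt (E d) a (f (x.1 t)) -
      (chartAt (E d) a a + x.1 t • L₂ (L₁ (0, b)))) =o[𝓝 0] fun t : ℝ => t := by
    have ht := tendsto_of_isNilpotentPath x.2
    rw [hx0] at ht
    exact (hfo.comp_tendsto ht).trans_isBigO hx
  have hfa : Arrow (realLine n) (ofManifold (𝓡 d) M n) f :=
    arrow_of_contMDiff (hf.of_le (mod_cast le_top))
  refine mk_eq_of_isLittleO (x := ⟨h ∘ v.1, v.2.comp hh⟩) (y := ⟨f ∘ x.1, x.2.comp hfa⟩) hn ?_ ?_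
  · simp [hv0, hha, hx0, hf0]
  · simp only [Function.comp_apply, hv0, hha]
    refine (((h₂.add ho).add ((L₂.isBigO_comp _ _).trans_isLittleO hdv)).sub hfx).congr_left
      fun t => ?_
    have hs : L₂ (L₁ (0, x.1 t • b)) = x.1 t • L₂ (L₁ (0, b)) := by
      rw [← map_smul, ← map_smul, Prod.smul_mk, smul_zero]
    rw [map_sub L₂ _ (L₁ _), hs]
    change _ = chartAt (E d) a (h (v.1 t)) - chartAt (E d) a (f (x.1 t))
    abel

end InfGeom

/-! ### The characterization of standard tangent vectors -/

/-- Let `1 ≤ n ≤ ∞` and let `M` be a smooth manifold of finite dimension `d`. A tangent vector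
`t : D → •M` is standard if and only if `t(0) ∈ M`. -/
theorem mainTheorem8 (n : ℕ∞) (hn : 1 ≤ n) (d : ℕ) (M : Type*) [TopologicalSpace M]
    [ChartedSpace (EuclideanSpace ℝ (Fin d)) M] [IsManifold (𝓡 d) ∞ M]
    (t : InfGeom.TangentVector n d M) :
    t ∈ InfGeom.StandardTangentVector n d M ↔
      t.1 (InfGeom.D.zero n) ∈ InfGeom.ordinaryPoints n d M := by
  open InfGeom InfGeom.CnSpace in
  constructor
  · rintro ⟨f, hf, h⟩
    exact ⟨f 0, (h (D.zero n)).symm⟩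
  rintro ⟨a, ha⟩
  have hmem (h : D n) : extLift (h : (realLine n).Ext) ∈ lineD n := by
    rw [lineD, mem_ofPred_eq, extCoord_extLift]
    exact h.2
  have hcoord (h : D n) : lineDCoord ⟨_, hmem h⟩ = h := Subtype.ext (extCoord_extLift _)
  obtain ⟨W, hW, h0W, m, T, f, δ, hf, hδ, hfδ⟩ :=
    t.2 _ _ isExtFigure_lineDCoord ⟨_, hmem (D.zero n)⟩
  have hDW := extLift_mem_of_isOpen hn hW h0W
  have ht (h : D n) : t.1 h = (δ (f ⟨_, hmem h, hDW h⟩) : ExtManifold n d M) := by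
    have := congrArg Subtype.val (hfδ ⟨_, hmem h, hDW h⟩)
    simpa only [Function.comp_apply, hcoord] using this
  rcases hδ with ⟨z, hz⟩ | ⟨V', k, hk, hδ⟩
  -- A constant generating figure forces `t` to be constantly `t(0) = a`.
  · refine ⟨fun _ => a, contMDiff_const, fun h => ?_⟩
    rw [ht, hz, ← hz (f ⟨_, hmem (D.zero n), hDW _⟩), ← ht, ← ha]
    obtain ⟨_, x, rfl, hx⟩ := h
    rfl
  obtain ⟨q, p, U, V, g, hg, -, h0V, hfg⟩ := hf ⟨_, hmem (D.zero n), h0W⟩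
  -- The formula for `f` holds only over `•V`; being an open set around `0`, it contains all of `D`.
  have hopen : IsOpen[extTopology 1] (extSet (n := n) V) :=
    TopologicalSpace.isOpen_generateFrom_of_mem ⟨V, rfl⟩
  have hDV := extLift_mem_of_isOpen hn hopen h0V
  obtain ⟨p, rfl⟩ := Quotient.exists_rep p
  have key (x : (realLine n).NilpotentPath) (hx : x.1 =O[𝓝 0] fun t : ℝ => t) :
      ∃ (v : (ofManifold (𝓡 m) V' n).NilpotentPath)
        (w : (ofManifold ((𝓡 q).prod (𝓡 1)) (U × V) n).NilpotentPath),
        t.1 ⟨Quotient.mk _ x, x, rfl, hx⟩ = Ext.map k hk (Quotient.mk _ v) ∧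
        ((fun t => (v.1 t : E m) - g (w.1 t)) =o[𝓝 0] fun t : ℝ => t) ∧
        ((fun t => ((w.1 t).1 : E q) - p.1 t) =o[𝓝 0] fun t : ℝ => t) ∧
        ((fun t => ((w.1 t).2 : E 1) - x.1 t • lineVector) =o[𝓝 0] fun t : ℝ => t) := by
    set h : D n := ⟨Quotient.mk _ x, x, rfl, hx⟩
    obtain ⟨w, hw1, hw2, hw⟩ := hfg ⟨_, hmem h, hDW h⟩ (hDV h)
    obtain ⟨v, hv, hv'⟩ := hδ (f ⟨_, hmem h, hDW h⟩)
    rw [hw] at hv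
    obtain ⟨w, rfl⟩ := Quotient.exists_rep w
    obtain ⟨v, rfl⟩ := Quotient.exists_rep v
    exact ⟨v, w, (ht h).trans hv', isLittleO_of_mk_eq_euclidean hv,
      isLittleO_of_mk_eq_euclidean hw1, isLittleO_of_mk_eq_euclidean hw2⟩
  -- The path `x = 0` supplies the base paths, which represent `t(0)`.
  obtain ⟨v₀, w₀, ht₀, hv₀, hw₀, hw₀'⟩ :=
    key ⟨fun _ => 0, (realLine n).isNilpotentPath_const 0⟩ (isBigO_zero _ _)
  obtain ⟨γ, hγ, H⟩ := exists_map_eq hn hg hk lineVector p.1 a v₀ w₀ hv₀ hw₀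
    (by simpa using hw₀') (ht₀.symm.trans ha.symm)
  refine ⟨γ, hγ, ?_⟩
  rintro ⟨_, x, rfl, hx⟩
  obtain ⟨v, w, htx, hv, hw, hw'⟩ := key x hx
  exact htx.trans (H x v w hx hv hw hw')
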